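/- Let $\widehat c$ be the real vector space of all sequences $\xi=\{\xi_j\}_{j=1}^\infty$ of real numbers with only finitely many nonzero terms. A symmetric norming function is a norm $\Phi:\widehat c\to[0,\infty)$ such that $\Phi(1,0,0,\ldots)=1$ and $\Phi(\{\xi_j\}_{j=1}^\infty)=\Phi(\{|\xi_{\theta(j)}|\}_{j=1}^\infty)$ for every $\xi\in\widehat c$ and every bijection $\theta:\mathbb N\to\mathbb N$. For an arbitrary real sequence $\xi$ put \[\Phi(\xi)=\lim_{m\to\infty}\Phi(\xi_1,\ldots,\xi_m,0,0,\ldots)\in[0,\infty]\] (the limit exists because these values are nondecreasing in $m$). Let $\mathcal H$ be an infinite-dimensional separable complex Hilbert space (for instance the Fock space $H^2(\mathbb C^n,d\mu)$, $n\ge 1$, with $d\mu(z)=\pi^{-n}e^{-|z|^2}dV(z)$) and let $\mathfrak L(\mathcal H)$ be the set of bounded operators on $\mathcal H$. For a positive operator $T\in\mathfrak L(\mathcal H)$, define $\lambda_j(T)$, $j=1,2,\ldots$, as follows. Let $\eta=\sup\sigma(T)$. If $\eta$ is an accumulation point of the spectrum $\sigma(T)$ or an eigenvalue of $T$ of infinite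 multiplicity, then $\lambda_j(T)=\eta$ for all $j$. Otherwise $\eta$ is an eigenvalue of finite multiplicity $p\geq 1$, and $\lambda_j(T)=\eta$ for $1\le j\le p$ and $\lambda_{p+j}(T)=\lambda_j(T-\eta P)$ for $j\ge1$, where $P$ is the orthogonal projection onto the eigenspace of $T$ for $\eta$. The s-numbers of $A\in\mathfrak L(\mathcal H)$ are $s_j(A)=\lambda_j((A^*A)^{1/2})$. For a symmetric norming function $\Phi$ let \[\mathcal C_\Phi=\{A\in\mathfrak L(\mathcal H):\Phi(\{s_j(A)\}_{j=1}^\infty)<\infty\}.\] Proposition. Let $\Phi$ and $\Psi$ be two symmetric norming functions. Then $\mathcal C_\Phi=\mathcal C_\Psi$ if and only if $\Phi$ and $\Psi$ are equivalent, that is, \[\sup_{\xi\in\widehat c,\ \xi\ne0}\frac{\Phi(\xi)}{\Psi(\xi)}<\infty\quad\text{and}\quad\sup_{\xi\in\widehat c,\ \xi\neq0}\frac{\Psi(\xi)}{\Phi(\xi)}<\infty.\] -/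

import Mathlib

open scoped ENNReal Topology

/-- A symmetric norming function on the space of finitely supported real sequences (indexed from
`0`): a norm `Φ` with `Φ(1,0,0,…) = 1` that depends only on the absolute values of the terms, up to
permutation. -/
structure SymmetricNormingFunction extends Seminorm ℝ (ℕ →₀ ℝ) where
  eq_zero_of_map_eq_zero : ∀ ξ : ℕ →₀ ℝ, toFun ξ = 0 → ξ = 0
  map_single_zero_one : toFun (Finsupp.single 0 1) = 1
  map_abs_perm : ∀ (θ : Equiv.Perm ℕ) (ξ ζ : ℕ →₀ ℝ), (∀ j, ζ j = |ξ (θ j)|) → toFun ξ = toFun ζ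

namespace SymmetricNormingFunction

noncomputable instance : CoeFun SymmetricNormingFunction (fun _ => (ℕ →₀ ℝ) → ℝ) :=
  ⟨fun Φ => Φ.toSeminorm⟩

end SymmetricNormingFunction

/-- The truncation `(ξ₀, …, ξ_{m-1}, 0, 0, …)` of a real sequence. -/
noncomputable def truncSeq (ξ : ℕ → ℝ) (m : ℕ) : ℕ →₀ ℝ :=
  ∑ j ∈ Finset.range m, Finsupp.single j (ξ j)

theorem truncSeq_apply (ξ : ℕ → ℝ) (m j : ℕ) :
    truncSeq ξ m j = if j < m then ξ j else 0 := by
  simp [truncSeq, Finsupp.finsetSum_apply, Finsupp.single_apply]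

namespace SymmetricNormingFunction

theorem map_truncSeq_le_succ (Φ : SymmetricNormingFunction) (ξ : ℕ → ℝ) (m : ℕ) :
    Φ (truncSeq ξ m) ≤ Φ (truncSeq ξ (m + 1)) := by
  set x := truncSeq ξ (m + 1) with hx
  set y := truncSeq ξ m - Finsupp.single m (ξ m) with hy
  have hxs : x = truncSeq ξ m + Finsupp.single m (ξ m) := by
    simp [hx, truncSeq, Finset.sum_range_succ]
  set z : ℕ →₀ ℝ := x.mapRange abs abs_zero with hz
  have hxz : Φ x = Φ z := Φ.map_abs_perm 1 x z (fun j => by simp [hz])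
  have hyz : Φ y = Φ z := by
    refine Φ.map_abs_perm 1 y z (fun j => ?_)
    simp only [hz, hxs, hy, Finsupp.mapRange_apply, Finsupp.add_apply, Finsupp.sub_apply,
      Equiv.Perm.coe_one, id_eq, truncSeq_apply, Finsupp.single_apply]
    by_cases h : m = j
    · subst h; simp
    · simp [h]
  have hsum : truncSeq ξ m = (1 / 2 : ℝ) • (x + y) := by
    rw [hxs, hy]
    ext j
    simp
    ring
  have h1 : Φ (truncSeq ξ m) = 1 / 2 * Φ (x + y) := by
    rw [hsum, map_smul_eq_mul]; norm_num
  have h2 : Φ (x + y) ≤ Φ x + Φ y := map_add_le_add _ _ _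
  linarith

/-- The extension of `Φ` to arbitrary real sequences, with values in `[0, ∞]`: the limit of `Φ`
along the truncations.  The values on truncations are nondecreasing (`map_truncSeq_le_succ`), so the
limit is the supremum; see `tendsto_ext`. -/
noncomputable def ext (Φ : SymmetricNormingFunction) (ξ : ℕ → ℝ) : ℝ≥0∞ :=
  ⨆ m : ℕ, ENNReal.ofReal (Φ (truncSeq ξ m))

theorem tendsto_ext (Φ : SymmetricNormingFunction) (ξ : ℕ → ℝ) :
    Filter.Tendsto (fun m => ENNReal.ofReal (Φ (truncSeq ξ m))) Filter.atTop (𝓝 (Φ.ext ξ)) :=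
  tendsto_atTop_iSup
    (monotone_nat_of_le_succ fun m => ENNReal.ofReal_le_ofReal (Φ.map_truncSeq_le_succ ξ m))

/-- `Φ ∼ Ψ`: both `Φ ξ / Ψ ξ` and `Ψ ξ / Φ ξ` are bounded above over the nonzero finitely supported
sequences `ξ`. -/
def Equivalent (Φ Ψ : SymmetricNormingFunction) : Prop :=
  BddAbove {r : ℝ | ∃ ξ : ℕ →₀ ℝ, ξ ≠ 0 ∧ r = Φ ξ / Ψ ξ} ∧
    BddAbove {r : ℝ | ∃ ξ : ℕ →₀ ℝ, ξ ≠ 0 ∧ r = Ψ ξ / Φ ξ}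

end SymmetricNormingFunction

section SNumbers

variable {H : Type*} [NormedAddCommGroup H] [InnerProductSpace ℂ H] [CompleteSpace H]

/-- The eigenspace of the bounded operator `T` for the real number `μ` (zero if `μ` is not an
eigenvalue). -/
def opEigenspace (T : H →L[ℂ] H) (μ : ℝ) : Submodule ℂ H :=
  (T - (μ : ℂ) • ContinuousLinearMap.id ℂ H).ker

instance (T : H →L[ℂ] H) (μ : ℝ) : (opEigenspace T μ).HasOrthogonalProjection := by
  have : CompleteSpace (opEigenspace T μ) :=
    (ContinuousLinearMap.isClosed_ker
      (T - (μ : ℂ) • ContinuousLinearMap.id ℂ H)).completeSpace_coe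
  infer_instance

/-- `μ` belongs to the condensed spectrum of the self-adjoint operator `T`: it is an accumulation
point of the spectrum or an eigenvalue of infinite multiplicity. -/
def InCondensedSpectrum (T : H →L[ℂ] H) (μ : ℝ) : Prop :=
  AccPt μ (Filter.principal (spectrum ℝ T)) ∨ ¬ FiniteDimensional ℂ (opEigenspace T μ)

/-- The supremum of the spectrum of a self-adjoint operator. -/
noncomputable def spectrumSup (T : H →L[ℂ] H) : ℝ := sSup (spectrum ℝ T)

open Classical in
/-- The numbers `λ_{j+1}(T)` of a positive operator `T`, with `η` the supremum of the spectrum.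
If `η` is in the condensed spectrum, all of them equal `η`.  Otherwise `η` is an eigenvalue of finite
multiplicity `p`, the first `p` of them equal `η`, and the remaining ones are those of `T - η P`,
with `P` the orthogonal projection onto the eigenspace of `η`.  (The case `p = 0` occurs only on
the zero space; it is there to make the recursion terminate.) -/
noncomputable def lambdaNumber (T : H →L[ℂ] H) (j : ℕ) : ℝ :=
  if InCondensedSpectrum T (spectrumSup T) then spectrumSup T
  else if _h : j < Module.finrank ℂ (opEigenspace T (spectrumSup T)) ∨
      Module.finrank ℂ (opEigenspace T (spectrumSup T)) = 0 then spectrumSup T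
  else lambdaNumber
    (T - (spectrumSup T : ℂ) • (opEigenspace T (spectrumSup T)).starProjection)
    (j - Module.finrank ℂ (opEigenspace T (spectrumSup T)))
termination_by j
decreasing_by omega

/-- The s-number `s_{j+1}(A) = λ_{j+1}((A* A)^{1/2})`. -/
noncomputable def sNumber (A : H →L[ℂ] H) (j : ℕ) : ℝ :=
  lambdaNumber (CFC.sqrt (ContinuousLinearMap.adjoint A * A)) j

end SNumbers

/-- The ideal `C_Φ` of all bounded operators `A` on `H` with `Φ(s₁(A), s₂(A), …) < ∞`. -/
def SymmetricNormingFunction.ideal (Φ : SymmetricNormingFunction) (H : Type*)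
    [NormedAddCommGroup H] [InnerProductSpace ℂ H] [CompleteSpace H] : Set (H →L[ℂ] H) :=
  {A | Φ.ext (sNumber A) < ∞}

/-! A bound on `Φ / Ψ` passes to truncations, so it gives `Ψ.ideal H ⊆ Φ.ideal H`. Conversely, if
the ratio is unbounded, choose nonincreasing nonnegative `u k` with `Ψ (u k) ≤ 2⁻ᵏ` and `Φ (u k) ≥
k`. Their coordinatewise sum has finite `Ψ` by countable subadditivity (`truncSeq_tsum_le`) and
infinite `Φ`, since it dominates every `u k` (`map_mono`).

Adding a geometric sequence makes the sum strictly decreasing and positive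
(`exists_strictAnti_of_not_bddAbove`). Such a sequence is the s-number sequence of a diagonal
operator (`exists_sNumber_eq`), which then lies in one ideal and not in the other. Strictness makes
every positive eigenvalue simple and isolated from the entries below it, so the recursion for
`lambdaNumber` removes one entry at a time. -/

namespace SymmetricNormingFunction

/-! ### Monotonicity and countable subadditivity of symmetric norming functions -/

variable (Φ : SymmetricNormingFunction)

theorem map_eq_of_abs_eq {x y : ℕ →₀ ℝ} (h : ∀ j, |x j| = |y j|) : Φ x = Φ y := by
  have hx := Φ.map_abs_perm 1 x (x.mapRange abs abs_zero) fun j => by simp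
  have hy := Φ.map_abs_perm 1 y (x.mapRange abs abs_zero) fun j => by simp [h]
  exact hx.trans hy.symm

theorem map_perm (θ : Equiv.Perm ℕ) {x y : ℕ →₀ ℝ} (h : ∀ j, |y j| = |x (θ j)|) : Φ x = Φ y := by
  have hx := Φ.map_abs_perm θ x (y.mapRange abs abs_zero) fun j => by simp [h]
  have hy := Φ.map_abs_perm 1 y (y.mapRange abs abs_zero) fun j => by simp
  exact hx.trans hy.symm

theorem map_single (j : ℕ) (r : ℝ) : Φ (Finsupp.single j r) = |r| := by
  have h0 : Φ (Finsupp.single 0 1) = 1 := Φ.map_single_zero_one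
  have h1 : Φ (Finsupp.single 0 1) = Φ (Finsupp.single j 1) := by
    refine Φ.map_perm (Equiv.swap 0 j) fun i => ?_
    congr 1
    simp only [Finsupp.single_apply]
    refine if_congr ?_ rfl rfl
    rw [eq_comm (a := 0), ← Equiv.eq_symm_apply, Equiv.symm_swap, Equiv.swap_apply_left, eq_comm]
  rw [← mul_one r, ← smul_eq_mul, ← Finsupp.smul_single, map_smul_eq_mul, ← h1, h0, smul_eq_mul,
    mul_one, mul_one, Real.norm_eq_abs]

theorem map_pos {x : ℕ →₀ ℝ} (hx : x ≠ 0) : 0 < Φ x :=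
  (apply_nonneg Φ.toSeminorm x).lt_of_ne fun h => hx (Φ.eq_zero_of_map_eq_zero x h.symm)

/-- The updated sequence is a convex combination of `y` and `y` with its sign flipped at `m`, and
these two have the same norm. -/
theorem map_update_le {y : ℕ →₀ ℝ} {m : ℕ} {s : ℝ} (hs : |s| ≤ |y m|) : Φ (y.update m s) ≤ Φ y := by
  by_cases hy : y m = 0
  · have : s = 0 := by simpa [hy] using hs
    rw [this, ← hy, Finsupp.update_self]
  set t := s / y m with ht
  have hst : s = t * y m := (div_mul_cancel₀ s hy).symm
  have ht1 : |t| ≤ 1 := by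
    rw [ht, abs_div]
    exact div_le_one_of_le₀ hs (abs_nonneg _)
  obtain ⟨hl, hu⟩ := abs_le.1 ht1
  have hflip : Φ (y.update m (-y m)) = Φ y := Φ.map_eq_of_abs_eq fun j => by
    by_cases hj : j = m
    · subst hj; simp
    · simp [hj]
  have hcomb : y.update m s = ((1 + t) / 2) • y + ((1 - t) / 2) • y.update m (-y m) := by
    ext j
    by_cases hj : j = m
    · subst hj
      simp [hst]
      ring
    · simp [hj]
      ring
  calc Φ (y.update m s)
      ≤ Φ (((1 + t) / 2) • y) + Φ (((1 - t) / 2) • y.update m (-y m)) := by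
        rw [hcomb]
        exact map_add_le_add _ _ _
    _ = Φ y := by
        rw [map_smul_eq_mul, map_smul_eq_mul, hflip, Real.norm_of_nonneg (by linarith),
          Real.norm_of_nonneg (by linarith)]
        ring

theorem map_mono {x y : ℕ →₀ ℝ} (h : ∀ j, |x j| ≤ |y j|) : Φ x ≤ Φ y := by
  obtain ⟨s, hs⟩ : ∃ s : Finset ℕ, ∀ j ∉ s, x j = y j :=
    ⟨x.support ∪ y.support, fun j hj => by
      simp only [Finset.mem_union, Finsupp.mem_support_iff, not_or, not_not] at hj
      rw [hj.1, hj.2]⟩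
  -- Change `y` into `x` one coordinate at a time over a finite set outside which they agree.
  induction s using Finset.induction_on generalizing y with
  | empty => rw [show x = y from Finsupp.ext fun j => hs j (Finset.notMem_empty j)]
  | insert m s hm ih =>
    refine (ih (y := y.update m (x m)) (fun j => ?_) fun j hj => ?_).trans (Φ.map_update_le (h m))
    · by_cases hj : j = m
      · subst hj; simp
      · simpa [hj] using h j
    · by_cases hjm : j = m
      · subst hjm; simp
      · simpa [hjm] using hs j (by simp [hjm, hj])

theorem abs_apply_le (x : ℕ →₀ ℝ) (j : ℕ) : |x j| ≤ Φ x := by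
  rw [← Φ.map_single j]
  refine Φ.map_mono fun i => ?_
  by_cases hi : i = j
  · subst hi; simp
  · simp [hi]

theorem map_sum_le {κ : Type*} (s : Finset κ) (u : κ → ℕ →₀ ℝ) :
    Φ (∑ k ∈ s, u k) ≤ ∑ k ∈ s, Φ (u k) :=
  Finset.le_sum_of_subadditive Φ.toSeminorm (map_zero _).le (map_add_le_add _) s u

theorem map_truncSeq_le_sum (x : ℕ → ℝ) (m : ℕ) :
    Φ (truncSeq x m) ≤ ∑ j ∈ Finset.range m, |x j| := by
  refine (Φ.map_sum_le _ _).trans_eq ?_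
  exact Finset.sum_congr rfl fun j _ => Φ.map_single j (x j)

theorem truncSeq_add (x y : ℕ → ℝ) (m : ℕ) :
    truncSeq (x + y) m = truncSeq x m + truncSeq y m := by
  ext j
  simp only [Finsupp.add_apply, truncSeq_apply, Pi.add_apply]
  split_ifs <;> simp

theorem map_truncSeq_coe_le (x : ℕ →₀ ℝ) (m : ℕ) : Φ (truncSeq x m) ≤ Φ x := by
  refine Φ.map_mono fun j => ?_
  rw [truncSeq_apply]
  split_ifs <;> simp

/-- Partial sums obey the triangle inequality. Only `m` coordinates of the remainder matter, and its
ℓ¹ norm on them tends to zero. -/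
theorem truncSeq_tsum_le {u : ℕ → ℕ →₀ ℝ} {c : ℕ → ℝ} {C : ℝ} (hu : ∀ k, Φ (u k) ≤ c k)
    (hc : HasSum c C) (m : ℕ) : Φ (truncSeq (fun j => ∑' k, u k j) m) ≤ C := by
  have hsum (j : ℕ) : Summable fun k => u k j :=
    Summable.of_norm_bounded hc.summable fun k => (Φ.abs_apply_le (u k) j).trans (hu k)
  have hc0 (k : ℕ) : 0 ≤ c k := (apply_nonneg Φ.toSeminorm (u k)).trans (hu k)
  have hpartial (K : ℕ) : Φ (truncSeq (fun j => ∑' k, u k j) m) ≤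
      C + ∑ j ∈ Finset.range m, |(∑' k, u k j) - ∑ k ∈ Finset.range K, u k j| := by
    have hsplit : (fun j => ∑' k, u k j) = ⇑(∑ k ∈ Finset.range K, u k) +
        fun j => (∑' k, u k j) - ∑ k ∈ Finset.range K, u k j := by
      ext j
      simp
    rw [hsplit, truncSeq_add]
    refine (map_add_le_add Φ.toSeminorm _ _).trans (add_le_add ?_ ?_)
    · refine (Φ.map_truncSeq_coe_le _ m).trans ((Φ.map_sum_le _ _).trans ?_)
      exact (Finset.sum_le_sum fun k _ => hu k).trans
        (sum_le_hasSum _ (fun k _ => hc0 k) hc)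
    · exact Φ.map_truncSeq_le_sum _ m
  have hlim : Filter.Tendsto (fun K => C + ∑ j ∈ Finset.range m,
      |(∑' k, u k j) - ∑ k ∈ Finset.range K, u k j|) Filter.atTop (𝓝 C) := by
    have h0 (j : ℕ) : Filter.Tendsto (fun K => |(∑' k, u k j) - ∑ k ∈ Finset.range K, u k j|)
        Filter.atTop (𝓝 0) := by
      simpa using ((hsum j).hasSum.tendsto_sum_nat.const_sub (∑' k, u k j)).abs
    simpa using (tendsto_finsetSum (Finset.range m) fun j _ => h0 j).const_add C
  exact ge_of_tendsto' hlim hpartial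

/-! ### Sequences that separate two inequivalent norming functions -/

/-- Every finitely supported sequence has a nonincreasing rearrangement of its absolute values. -/
theorem exists_antitone_rearrangement (x : ℕ →₀ ℝ) :
    ∃ y : ℕ →₀ ℝ, Antitone y ∧ (∀ j, 0 ≤ y j) ∧ ∀ Φ : SymmetricNormingFunction, Φ y = Φ x := by
  obtain ⟨n, hn⟩ : ∃ n, ∀ j, n ≤ j → x j = 0 := by
    refine ⟨x.support.sup id + 1, fun j hj => ?_⟩
    by_contra h
    have := Finset.le_sup (f := id) (Finsupp.mem_support_iff.2 h)
    simp only [id] at this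
    omega
  -- `Tuple.sort` sorts increasingly, hence the minus sign.
  let g : Fin n → ℝ := fun i => -|x i|
  let θ : Equiv.Perm ℕ := (Tuple.sort g).extendDomain Fin.equivSubtype
  have hθ (i : Fin n) : θ i = Tuple.sort g i :=
    Equiv.Perm.extendDomain_apply_image (Tuple.sort g) Fin.equivSubtype i
  have hθ' (j : ℕ) (hj : n ≤ j) : x (θ j) = 0 := by
    rw [show θ j = j from Equiv.Perm.extendDomain_apply_not_subtype _ _ (not_lt.2 hj), hn j hj]
  let y : ℕ →₀ ℝ := (x.mapRange abs abs_zero).equivMapDomain θ.symm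
  have hy (j : ℕ) : y j = |x (θ j)| := by simp [y, Finsupp.equivMapDomain_apply]
  refine ⟨y, fun i j hij => ?_, fun j => (hy j).symm ▸ abs_nonneg _, fun Φ => ?_⟩
  · rw [hy, hy]
    rcases lt_or_ge j n with hj | hj
    · have := Tuple.monotone_sort g (a := ⟨i, hij.trans_lt hj⟩) (b := ⟨j, hj⟩) hij
      simp only [Function.comp_apply, g, neg_le_neg_iff, ← hθ] at this
      exact this
    · rw [hθ' j hj, abs_zero]
      exact abs_nonneg _
  · exact (Φ.map_perm θ fun j => by rw [hy, abs_abs]).symm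

/-- If `Φ / Ψ` is unbounded, some strictly decreasing positive sequence has finite `Ψ` and
infinite `Φ`. -/
theorem exists_strictAnti_of_not_bddAbove {Φ Ψ : SymmetricNormingFunction}
    (h : ¬ BddAbove {r : ℝ | ∃ ξ : ℕ →₀ ℝ, ξ ≠ 0 ∧ r = Φ ξ / Ψ ξ}) :
    ∃ a : ℕ → ℝ, StrictAnti a ∧ (∀ j, 0 < a j) ∧ Ψ.ext a < ∞ ∧ Φ.ext a = ∞ := by
  have hblock (k : ℕ) : ∃ u : ℕ →₀ ℝ, Antitone u ∧ (∀ j, 0 ≤ u j) ∧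
      Ψ u ≤ (1 / 2 : ℝ) ^ k ∧ (k : ℝ) ≤ Φ u := by
    -- With ratio above `k * 2 ^ k`, scaling `Ψ` down to `2⁻ᵏ` still leaves `Φ` at least `k`.
    obtain ⟨_, ⟨ξ, hξ, rfl⟩, hlt⟩ := not_bddAbove_iff.1 h (k * 2 ^ k)
    obtain ⟨y, hanti, hnonneg, hy⟩ := exists_antitone_rearrangement ξ
    have hpos := Ψ.map_pos hξ
    have hc : 0 < (1 / 2 : ℝ) ^ k / Ψ ξ := by positivity
    refine ⟨((1 / 2 : ℝ) ^ k / Ψ ξ) • y, fun i j hij => ?_, fun j => ?_, ?_, ?_⟩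
    · simpa using mul_le_mul_of_nonneg_left (hanti hij) hc.le
    · simpa using mul_nonneg hc.le (hnonneg j)
    · rw [map_smul_eq_mul, hy, Real.norm_of_nonneg hc.le, div_mul_cancel₀ _ hpos.ne']
    · rw [map_smul_eq_mul, hy, Real.norm_of_nonneg hc.le, div_mul_eq_mul_div, mul_div_assoc]
      have h2 : (1 / 2 : ℝ) ^ k * (k * 2 ^ k) = k := by
        rw [mul_left_comm, ← mul_pow]
        norm_num
      rw [← h2]
      gcongr
  choose u hanti hnonneg hΨ hΦ using hblock
  have hgeom : HasSum (fun k : ℕ => (1 / 2 : ℝ) ^ k) 2 := hasSum_geometric_two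
  have hsum (j : ℕ) : Summable fun k => u k j :=
    Summable.of_norm_bounded hgeom.summable fun k => (Ψ.abs_apply_le (u k) j).trans (hΨ k)
  -- The sum of the blocks is only nonincreasing and nonnegative; `g` makes both properties strict
  -- at a cost of at most 2 in `Ψ`.
  let g : ℕ → ℝ := fun j => (1 / 2) ^ j
  let s : ℕ → ℝ := fun j => ∑' k, u k j
  have hg (j : ℕ) : 0 < g j := by positivity
  have hs (j : ℕ) : 0 ≤ s j := tsum_nonneg fun k => hnonneg k j
  refine ⟨s + g, ?_, fun j => add_pos_of_nonneg_of_pos (hs j) (hg j), ?_, ?_⟩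
  · intro i j hij
    exact add_lt_add_of_le_of_lt ((hsum j).tsum_le_tsum (fun k => hanti k hij.le) (hsum i))
      (pow_lt_pow_right_of_lt_one₀ (by norm_num) (by norm_num) hij)
  · refine lt_of_le_of_lt (iSup_le fun m => ENNReal.ofReal_le_ofReal ?_)
      (ENNReal.ofReal_lt_top (r := 2 + 2))
    rw [truncSeq_add]
    refine (map_add_le_add Ψ.toSeminorm _ _).trans (add_le_add ?_ ?_)
    · exact Ψ.truncSeq_tsum_le hΨ hgeom m
    · refine (Ψ.map_truncSeq_le_sum g m).trans ?_
      simp only [abs_of_pos (hg _)]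
      exact sum_le_hasSum _ (fun j _ => (hg j).le) hgeom
  · refine ENNReal.eq_top_of_forall_nnreal_le fun r => ?_
    obtain ⟨k, hk⟩ := exists_nat_ge (r : ℝ)
    -- This truncation covers the whole support of `u k`, so it dominates `u k` everywhere.
    refine le_iSup_of_le ((u k).support.sup id + 1) ?_
    rw [← ENNReal.ofReal_coe_nnreal]
    refine ENNReal.ofReal_le_ofReal (hk.trans ((hΦ k).trans (Φ.map_mono fun j => ?_)))
    rw [truncSeq_apply]
    split_ifs with hj
    · have h1 : u k j ≤ s j := (hsum j).le_tsum k fun i _ => hnonneg i j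
      have h2 : s j ≤ (s + g) j := le_add_of_nonneg_right (hg j).le
      rw [abs_of_nonneg (hnonneg k j), abs_of_nonneg ((hs j).trans h2)]
      exact h1.trans h2
    · rw [not_lt, Nat.add_one_le_iff] at hj
      have : u k j = 0 := by
        by_contra hne
        exact hj.not_ge (Finset.le_sup (f := id) (Finsupp.mem_support_iff.2 hne))
      simp [this]

theorem ext_lt_top_of_bddAbove {Φ Ψ : SymmetricNormingFunction}
    (h : BddAbove {r : ℝ | ∃ ξ : ℕ →₀ ℝ, ξ ≠ 0 ∧ r = Φ ξ / Ψ ξ}) {a : ℕ → ℝ}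
    (ha : Ψ.ext a < ∞) : Φ.ext a < ∞ := by
  obtain ⟨C, hC⟩ := h
  have hle (ξ : ℕ →₀ ℝ) : Φ ξ ≤ |C| * Ψ ξ := by
    by_cases hξ : ξ = 0
    · subst hξ
      rw [map_zero, map_zero, mul_zero]
    · rw [← div_le_iff₀ (Ψ.map_pos hξ)]
      exact (hC ⟨ξ, hξ, rfl⟩).trans (le_abs_self C)
  refine lt_of_le_of_lt (iSup_le fun m => ?_)
    (ENNReal.mul_lt_top (ENNReal.ofReal_lt_top (r := |C|)) ha)
  calc ENNReal.ofReal (Φ (truncSeq a m))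
      ≤ ENNReal.ofReal (|C| * Ψ (truncSeq a m)) := ENNReal.ofReal_le_ofReal (hle _)
    _ = ENNReal.ofReal |C| * ENNReal.ofReal (Ψ (truncSeq a m)) :=
        ENNReal.ofReal_mul (abs_nonneg C)
    _ ≤ ENNReal.ofReal |C| * Ψ.ext a := by
        gcongr
        exact le_iSup (fun m => ENNReal.ofReal (Ψ (truncSeq a m))) m

end SymmetricNormingFunction

/-! ### Diagonal operators, their spectra and s-numbers -/

section Diagonal

variable {ι H : Type*} [NormedAddCommGroup H] [InnerProductSpace ℂ H]

/-- `T` is the diagonal operator with real entries `d` in the Hilbert basis `b`. -/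
def HilbertBasis.IsDiagonal (b : HilbertBasis ι ℂ H) (T : H →L[ℂ] H) (d : ι → ℝ) : Prop :=
  ∀ x i, b.repr (T x) i = (d i : ℂ) * b.repr x i

namespace HilbertBasis

variable {b : HilbertBasis ι ℂ H} {T S : H →L[ℂ] H} {d e : ι → ℝ}

theorem ext_repr (b : HilbertBasis ι ℂ H) {x y : H} (h : ∀ i, b.repr x i = b.repr y i) : x = y :=
  b.repr.injective (lp.ext (funext h))

theorem infinite_index (b : HilbertBasis ι ℂ H) (hH : ¬ FiniteDimensional ℂ H) : Infinite ι := by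
  by_contra h
  have : Finite ι := not_infinite_iff_finite.1 h
  have := Fintype.ofFinite ι
  exact hH b.toOrthonormalBasis.toBasis.finiteDimensional_of_finite

theorem exists_isDiagonal (b : HilbertBasis ι ℂ H) (d : ι → ℝ) {C : ℝ} (hC : ∀ i, |d i| ≤ C) :
    ∃ T, b.IsDiagonal T d := by
  have hK (i : ι) : ‖(d i : ℂ) • ContinuousLinearMap.id ℂ ℂ‖ ≤ |C| := by
    rw [norm_smul, ContinuousLinearMap.norm_id, mul_one, Complex.norm_real, Real.norm_eq_abs]
    exact (hC i).trans (le_abs_self C)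
  refine ⟨b.repr.symm.toContinuousLinearEquiv.toContinuousLinearMap ∘L
    lp.mapCLM 2 _ (abs_nonneg C) hK ∘L b.repr.toContinuousLinearEquiv.toContinuousLinearMap, ?_⟩
  intro x i
  simp [-Complex.coe_smul]

namespace IsDiagonal

theorem ext_entries (hT : b.IsDiagonal T d) (hS : b.IsDiagonal S e) (h : ∀ i, d i = e i) :
    T = S := by
  ext x
  exact b.ext_repr fun i => by rw [hT, hS, h]

theorem one (b : HilbertBasis ι ℂ H) : b.IsDiagonal 1 fun _ => 1 := by
  intro x i
  simp

theorem algebraMap_sub (h : b.IsDiagonal T d) (μ : ℝ) :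
    b.IsDiagonal (algebraMap ℝ (H →L[ℂ] H) μ - T) (fun i => μ - d i) := by
  intro x i
  have : (algebraMap ℝ (H →L[ℂ] H) μ) x = (μ : ℂ) • x := by
    simp [Algebra.algebraMap_eq_smul_one]
  rw [sub_apply, this, map_sub, map_smul, lp.coeFn_sub, Pi.sub_apply, h,
    lp.coeFn_smul, Pi.smul_apply, smul_eq_mul]
  push_cast
  ring

theorem mul (hT : b.IsDiagonal T d) (hS : b.IsDiagonal S e) :
    b.IsDiagonal (T * S) (fun i => d i * e i) := by
  intro x i
  simp [hT (S x) i, hS x i, mul_assoc]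

theorem apply_self (h : b.IsDiagonal T d) (i : ι) : T (b i) = (d i : ℂ) • b i := by
  classical
  refine b.ext_repr fun j => ?_
  rw [h, map_smul, b.repr_self, lp.coeFn_smul, Pi.smul_apply, smul_eq_mul]
  by_cases hij : j = i
  · subst hij; simp
  · simp [hij]

/-- The resolvent is the diagonal operator with entries `(μ - d i)⁻¹`, bounded by `ε⁻¹`. -/
theorem notMem_spectrum (h : b.IsDiagonal T d) {μ ε : ℝ} (hε : 0 < ε)
    (hd : ∀ i, ε ≤ |μ - d i|) : μ ∉ spectrum ℝ T := by
  obtain ⟨S, hS⟩ := b.exists_isDiagonal (fun i => (μ - d i)⁻¹) (C := ε⁻¹) fun i => by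
    rw [abs_inv]
    exact inv_anti₀ hε (hd i)
  have hne (i : ι) : μ - d i ≠ 0 := abs_pos.1 (hε.trans_le (hd i))
  have hR := h.algebraMap_sub μ
  rw [spectrum.notMem_iff]
  exact ⟨⟨_, S, (hR.mul hS).ext_entries (one b) fun i => mul_inv_cancel₀ (hne i),
    (hS.mul hR).ext_entries (one b) fun i => inv_mul_cancel₀ (hne i)⟩, rfl⟩

theorem mem_spectrum (h : b.IsDiagonal T d) (i : ι) : d i ∈ spectrum ℝ T := by
  rw [spectrum.mem_iff]
  rintro ⟨u, hu⟩
  have h0 : (u : H →L[ℂ] H) (b i) = 0 := by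
    rw [hu, (h.algebraMap_sub (d i)).apply_self]
    simp
  have h1 : b i = 0 := by
    have : ((↑u⁻¹ * ↑u : H →L[ℂ] H)) (b i) = 0 := by
      rw [mul_apply_eq_comp, h0, map_zero]
    rwa [Units.inv_mul] at this
  exact b.orthonormal.ne_zero i h1

theorem isPositive (h : b.IsDiagonal T d) (hd : ∀ i, 0 ≤ d i) : T.IsPositive := by
  rw [ContinuousLinearMap.isPositive_def]
  refine ⟨fun x y => ?_, fun x => ?_⟩
  · change inner ℂ (T x) y = inner ℂ x (T y)
    rw [← b.repr.inner_map_map, ← b.repr.inner_map_map, lp.inner_eq_tsum, lp.inner_eq_tsum]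
    refine tsum_congr fun i => ?_
    rw [h, h]
    simp
    ring
  · rw [ContinuousLinearMap.reApplyInnerSelf_apply, ← b.repr.inner_map_map]
    have hs := RCLike.hasSum_re ℂ (lp.hasSum_inner (b.repr (T x)) (b.repr x))
    refine hs.nonneg fun i => ?_
    have : inner ℂ (b.repr (T x) i) (b.repr x i)
        = ((d i * ‖b.repr x i‖ ^ 2 : ℝ) : ℂ) := by
      rw [h]
      simp [← Complex.conj_mul']
      ring
    rw [this, RCLike.re_eq_complex_re, Complex.ofReal_re]
    exact mul_nonneg (hd i) (sq_nonneg _)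

section TopEntry

variable {i₀ : ι} {r : ℝ}

theorem spectrumSup_eq [CompleteSpace H] (h : b.IsDiagonal T d) (hd : ∀ i, d i ≤ d i₀) :
    spectrumSup T = d i₀ := by
  refine IsGreatest.csSup_eq ⟨h.mem_spectrum i₀, fun μ hμ => ?_⟩
  by_contra! hlt
  refine h.notMem_spectrum (sub_pos.2 hlt) (fun i => ?_) hμ
  exact (sub_le_sub_left (hd i) μ).trans (le_abs_self _)

/-- A point above `r` other than `d i₀` has positive distance to all entries, so it is not in the
spectrum. -/
theorem not_accPt_spectrum (h : b.IsDiagonal T d) (hr : r < d i₀) (hd : ∀ i ≠ i₀, d i ≤ r) :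
    ¬ AccPt (d i₀) (Filter.principal (spectrum ℝ T)) := by
  rw [accPt_iff_nhds]
  intro hacc
  obtain ⟨μ, ⟨hμr, hμ⟩, hne⟩ := hacc (Set.Ioi r) (Ioi_mem_nhds hr)
  refine h.notMem_spectrum (lt_min (sub_pos.2 hμr) (abs_pos.2 (sub_ne_zero.2 hne))) (fun i => ?_) hμ
  by_cases hi : i = i₀
  · rw [hi]
    exact min_le_right _ _
  · exact (min_le_left _ _).trans ((sub_le_sub_left (hd i hi) μ).trans (le_abs_self _))

theorem opEigenspace_eq [CompleteSpace H] (h : b.IsDiagonal T d) (hd : ∀ i ≠ i₀, d i ≠ d i₀) :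
    opEigenspace T (d i₀) = ℂ ∙ b i₀ := by
  classical
  ext x
  have hmem : x ∈ opEigenspace T (d i₀) ↔ T x = (d i₀ : ℂ) • x := by
    change T x - (d i₀ : ℂ) • x = 0 ↔ _
    exact sub_eq_zero
  rw [hmem, Submodule.mem_span_singleton]
  constructor
  · intro hx
    refine ⟨b.repr x i₀, b.ext_repr fun i => ?_⟩
    rw [map_smul, b.repr_self, lp.coeFn_smul, Pi.smul_apply, smul_eq_mul]
    by_cases hi : i = i₀
    · subst hi; simp
    · have h1 := h x i
      rw [hx, map_smul, lp.coeFn_smul, Pi.smul_apply, smul_eq_mul] at h1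
      have h2 : ((d i₀ : ℂ) - d i) ≠ 0 := sub_ne_zero.2 (by exact_mod_cast (hd i hi).symm)
      have h3 : b.repr x i = 0 := by
        refine (mul_eq_zero.1 ?_).resolve_left h2
        rw [sub_mul, h1, sub_self]
      simp [hi, h3]
  · rintro ⟨c, rfl⟩
    rw [map_smul, h.apply_self, smul_comm]

theorem sub_smul_starProjection [DecidableEq ι] (h : b.IsDiagonal T d) :
    b.IsDiagonal (T - (d i₀ : ℂ) • (ℂ ∙ b i₀).starProjection) (Function.update d i₀ 0) := by
  intro x i
  have hP : (ℂ ∙ b i₀).starProjection x = b.repr x i₀ • b i₀ := by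
    rw [Submodule.starProjection_unit_singleton ℂ (b.orthonormal.1 i₀), b.repr_apply_apply]
  have h1 : b.repr ((T - (d i₀ : ℂ) • (ℂ ∙ b i₀).starProjection) x) i
      = (d i : ℂ) * b.repr x i - d i₀ * (b.repr x i₀ * b.repr (b i₀) i) := by
    rw [← h x i, sub_apply, smul_apply, hP, map_sub, map_smul, map_smul]
    rfl
  rw [h1, b.repr_self]
  by_cases hi : i = i₀
  · subst hi; simp
  · simp [hi]

/-- The gap between `r` and `d i₀` makes the top eigenvalue isolated and simple, so the recursion
runs with multiplicity one. -/
theorem lambdaNumber_eq_ite [CompleteSpace H] (h : b.IsDiagonal T d) (hr : r < d i₀)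
    (hd : ∀ i ≠ i₀, d i ≤ r) (j : ℕ) :
    lambdaNumber T j = if j = 0 then d i₀
      else lambdaNumber (T - (d i₀ : ℂ) • (ℂ ∙ b i₀).starProjection) (j - 1) := by
  have hsup : spectrumSup T = d i₀ := h.spectrumSup_eq fun i => by
    by_cases hi : i = i₀
    · rw [hi]
    · exact (hd i hi).trans hr.le
  have heig : opEigenspace T (d i₀) = ℂ ∙ b i₀ :=
    h.opEigenspace_eq fun i hi => ((hd i hi).trans_lt hr).ne
  have hrank : Module.finrank ℂ (opEigenspace T (spectrumSup T)) = 1 := by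
    rw [hsup, heig, finrank_span_singleton (b.orthonormal.ne_zero i₀)]
  have hcond : ¬ InCondensedSpectrum T (d i₀) := by
    rintro (hacc | hinf)
    · exact h.not_accPt_spectrum hr hd hacc
    · exact hinf (Module.finite_of_finrank_pos (by rw [← hsup, hrank]; exact one_pos))
  have hproj : (opEigenspace T (d i₀)).starProjection = (ℂ ∙ b i₀).starProjection := by
    simp only [heig]
  rw [lambdaNumber]
  simp only [hrank]
  simp only [hsup, hcond, if_false, hproj, Nat.lt_one_iff, one_ne_zero, or_false, dite_eq_ite]

end TopEntry

theorem entry_le_second {f : ℕ → ι} (hanti : StrictAnti (d ∘ f)) (hpos : ∀ j, 0 < d (f j))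
    (hzero : ∀ i ∉ Set.range f, d i = 0) : ∀ i ≠ f 0, d i ≤ d (f 1) := by
  intro i hi
  by_cases hif : i ∈ Set.range f
  · obtain ⟨k, rfl⟩ := hif
    exact hanti.antitone (Nat.one_le_iff_ne_zero.2 fun hk => hi (by rw [hk]))
  · rw [hzero i hif]
    exact (hpos 1).le

theorem lambdaNumber_eq [CompleteSpace H] (h : b.IsDiagonal T d) {f : ℕ → ι}
    (hf : f.Injective) (hanti : StrictAnti (d ∘ f)) (hpos : ∀ j, 0 < d (f j))
    (hzero : ∀ i ∉ Set.range f, d i = 0) (j : ℕ) : lambdaNumber T j = d (f j) := by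
  classical
  -- Removing the top entry leaves a diagonal operator of the same kind: `f` is shifted by one, and
  -- the index `f 0` joins those with entry zero.
  induction j generalizing T d f with
  | zero => exact (h.lambdaNumber_eq_ite (hanti Nat.zero_lt_one) (entry_le_second hanti hpos hzero)
      0).trans (if_pos rfl)
  | succ j ih =>
    rw [h.lambdaNumber_eq_ite (hanti Nat.zero_lt_one) (entry_le_second hanti hpos hzero)]
    have hne (k : ℕ) : f (k + 1) ≠ f 0 := hf.ne k.succ_ne_zero
    rw [if_neg j.succ_ne_zero, Nat.add_sub_cancel,
      ih h.sub_smul_starProjection (f := fun k => f (k + 1))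
        (fun k l hkl => Nat.succ_injective (hf hkl))]
    · rw [Function.update_of_ne (hne j)]
    · intro k l hkl
      simp only [Function.comp_apply, Function.update_of_ne (hne _)]
      exact hanti (Nat.succ_lt_succ hkl)
    · intro k
      rw [Function.update_of_ne (hne k)]
      exact hpos _
    · intro i hi
      by_cases hi0 : i = f 0
      · rw [hi0, Function.update_self]
      · rw [Function.update_of_ne hi0]
        refine hzero i ?_
        rintro ⟨k, rfl⟩
        cases k with
        | zero => exact hi0 rfl
        | succ k => exact hi ⟨k, rfl⟩

end IsDiagonal
end HilbertBasis

theorem ContinuousLinearMap.IsPositive.sNumber_eq [CompleteSpace H] {T : H →L[ℂ] H}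
    (hT : T.IsPositive) : sNumber T = lambdaNumber T := by
  have hadj : ContinuousLinearMap.adjoint T = T := hT.isSelfAdjoint.adjoint_eq
  ext j
  rw [sNumber, hadj, CFC.sqrt_mul_self T ((ContinuousLinearMap.nonneg_iff_isPositive T).2 hT)]

/-- Every strictly decreasing sequence of positive numbers is the sequence of s-numbers of a bounded
operator on a given infinite-dimensional Hilbert space. -/
theorem exists_sNumber_eq [CompleteSpace H] (hH : ¬ FiniteDimensional ℂ H) {a : ℕ → ℝ}
    (hanti : StrictAnti a) (hpos : ∀ j, 0 < a j) : ∃ T : H →L[ℂ] H, sNumber T = a := by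
  obtain ⟨w, b, -⟩ := exists_hilbertBasis ℂ H
  have := b.infinite_index hH
  -- The embedding need not be onto, so `d` is zero off its range; these entries lie below every `a
  -- j` and the recursion never reaches them.
  let f := Infinite.natEmbedding w
  let d : w → ℝ := Function.extend f a 0
  have hdf (j : ℕ) : d (f j) = a j := f.injective.extend_apply a _ j
  have hzero : ∀ i ∉ Set.range f, d i = 0 := fun i hi => Function.extend_apply' a _ i hi
  have hd (i : w) : 0 ≤ d i ∧ d i ≤ a 0 := by
    by_cases hi : i ∈ Set.range f
    · obtain ⟨j, rfl⟩ := hi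
      rw [hdf]
      exact ⟨(hpos j).le, hanti.antitone j.zero_le⟩
    · rw [hzero i hi]
      exact ⟨le_rfl, (hpos 0).le⟩
  obtain ⟨T, hT⟩ := b.exists_isDiagonal d (C := a 0) fun i =>
    (abs_of_nonneg (hd i).1).trans_le (hd i).2
  refine ⟨T, ?_⟩
  rw [(hT.isPositive fun i => (hd i).1).sNumber_eq]
  ext j
  rw [hT.lambdaNumber_eq f.injective (by rwa [show d ∘ f = a from funext hdf])
    (fun j => (hdf j).symm ▸ hpos j) hzero, hdf]

end Diagonal

/-! ### Comparison of the ideals -/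

/-- The ratio `Φ / Ψ` is bounded exactly when the ideal of `Ψ` is contained in that of `Φ`. -/
theorem SymmetricNormingFunction.ideal_subset_iff (Φ Ψ : SymmetricNormingFunction) {H : Type*}
    [NormedAddCommGroup H] [InnerProductSpace ℂ H] [CompleteSpace H]
    (hH : ¬ FiniteDimensional ℂ H) :
    Ψ.ideal H ⊆ Φ.ideal H ↔ BddAbove {r : ℝ | ∃ ξ : ℕ →₀ ℝ, ξ ≠ 0 ∧ r = Φ ξ / Ψ ξ} := by
  refine ⟨fun h => ?_, fun h A hA => ext_lt_top_of_bddAbove h hA⟩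
  by_contra hunb
  obtain ⟨a, hanti, hpos, hΨ, hΦ⟩ := exists_strictAnti_of_not_bddAbove hunb
  obtain ⟨T, rfl⟩ := exists_sNumber_eq hH hanti hpos
  exact (h (show T ∈ Ψ.ideal H from hΨ)).ne hΦ

theorem proposition3p3 (Φ Ψ : SymmetricNormingFunction) (H : Type*) [NormedAddCommGroup H]
    [InnerProductSpace ℂ H] [CompleteSpace H] [TopologicalSpace.SeparableSpace H]
    (hH : ¬ FiniteDimensional ℂ H) :
    Φ.ideal H = Ψ.ideal H ↔ Φ.Equivalent Ψ := by
  rw [Set.Subset.antisymm_iff, and_comm]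
  exact and_congr (Φ.ideal_subset_iff Ψ hH) (Ψ.ideal_subset_iff Φ hH)
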